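/- Throughout, \(\mathbb N=\{0,1,2,\dots\}\), \(r\ge 1\) is an integer, and a linear functional is a linear map \(v:\mathbb C[x]\to\mathbb C\), \(f\mapsto\langle v,f\rangle\); for a polynomial \(A\), the functional \(A\,v\) is defined by \(\langle A\,v,f\rangle=\langle v,Af\rangle\). Let \((w_1,\dots,w_r)\) be a system of linear functionals and \(\vec n=(n_1,\dots,n_r)\in\mathbb N^r\), \(|\vec n|=n_1+\dots+n_r\). A type II multiple orthogonal polynomial for \(\vec n\) is a monic polynomial \(P\) of degree \(|\vec n|\) with \(\langle w_i,x^kP\rangle=0\) for \(0\le k\le n_i-1\), \(1\le i\le r\). A vector of type I multiple orthogonal polynomials for \(\vec n\) is \((A_1,\dots,A_r)\in\mathbb C[x]^r\) with \(\deg A_i\le n_i-1\) (\(A_i=0\) if \(n_i=0\)) such that the type I linear form \(q=\sum_{i=1}^rA_i\,w_i\) satisfies \(\langle q,x^m\rangle=0\) for \(0\le m\le|\vec n|-2\) and \(\langle q,x^{m}\rangle=1\) for \(m=|\vec n|-1\ge 0\). The multi-index of norm \(n=rk+j\) (\(k\in\mathbb N\), \(0\le j\le r-1\)) on the step-line has its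 first \(j\) entries equal to \(k+1\) and the others equal to \(k\). The \(m\)-th type I linear form \(q_m\) on the step-line is the one for the step-line multi-index of norm \(m+1\). A sequence \((P_n)_{n\in\mathbb N}\) of monic polynomials with \(\deg P_n=n\) is \(r\)-orthogonal with respect to \((w_1,\dots,w_r)\) if, for \(1\le i\le r\) and \(k,n\in\mathbb N\), \(\langle w_i,x^kP_n\rangle\) is nonzero for \(n=rk+i-1\) and zero for \(n\ge rk+i\); it is \((r+1)\)-fold symmetric if \(P_n(e^{2\pi i/(r+1)}x)=e^{2n\pi i/(r+1)}P_n(x)\) for all \(n\). **Theorem.** Let \((v_1,\dots,v_r)\) be a system of linear functionals with \(\langle v_i,1\rangle=1\) for \(1\le i\le r\), and put \[V^{[j]}=(v_{j+1},\dots,v_r,\,x\,v_1,\dots,x\,v_j),\qquad 0\le j\le r.\] There exist formal power series \((g_k)_{k\in\mathbb N}\) over \(\mathbb C\) with constant term \(1\) and complex numbers \(\alpha_k\neq0\), \(k\in\mathbb N\), such that \[g_0(t)=1,\qquad g_i(t)=\sum_{n\ge0}\langle v_i,x^n\rangle t^n\ (1\le i\le r),\qquad g_{k+1}(t)-g_k(t)=\alpha_k\,t\,g_{k+r+1}(t)\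 (k\in\mathbb N),\tag{$*$}\] if and only if, for each \(0\le j\le r\), all the multiple orthogonal polynomials (of type I and type II) on the step-line with respect to \(V^{[j]}\) exist and are unique. Moreover, for any such \((g_k)\) and \((\alpha_k)\) satisfying \((*)\): 1. The unique polynomial sequence with \(P_j(x)=x^j\) for \(0\le j\le r\) and \(P_{n+r+1}(x)=x\,P_{n+r}(x)-\alpha_nP_n(x)\) for all \(n\in\mathbb N\) is \((r+1)\)-fold symmetric and is \(r\)-orthogonal with respect to some system of \(r\) linear functionals, and \[P_{(r+1)n+j}(x)=x^j\,P^{[j]}_n(x^{r+1})\qquad(n\in\mathbb N,\ 0\le j\le r),\] where \((P^{[j]}_n)_{n\in\mathbb N}\) is the unique \(r\)-orthogonal sequence with respect to \(V^{[j]}\). 2. \(g_0(t)=1\) and \[g_{(r+1)m+j+1}(t)=\sum_{n\ge0}\langle q^{[j]}_m,x^{n+m}\rangle\,t^n\qquad(m\in\mathbb N,\ 0\le j\le r),\] where \((q^{[j]}_m)_{m\in\mathbb N}\) is the sequence of (existing and unique) type I linear forms on the step-line with respect to \(V^{[j]}\). -/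

import Mathlib

open scoped Polynomial

namespace MOP

/-- Linear functionals on `ℂ[x]`. -/
abbrev Functional := ℂ[X] →ₗ[ℂ] ℂ

/-- The functional `A(x) v`, defined by `⟨A v, f⟩ = ⟨v, A f⟩`. -/
noncomputable def polyMul (A : ℂ[X]) (v : Functional) : Functional :=
  v ∘ₗ LinearMap.mulLeft ℂ A

/-- `P` is a type II multiple orthogonal polynomial for the system `v` and the multi-index `n`:
it is monic of degree `|n|` and `⟨v_i, x^k P⟩ = 0` for `0 ≤ k ≤ n_i - 1`. -/
structure IsTypeII {r : ℕ} (v : Fin r → Functional) (n : Fin r → ℕ) (P : ℂ[X]) : Prop where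
  monic : P.Monic
  natDegree_eq : P.natDegree = ∑ i, n i
  orthogonal : ∀ (i : Fin r) (k : ℕ), k < n i → v i (Polynomial.X ^ k * P) = 0

/-- The linear form `∑ i, A_i(x) v_i`. -/
noncomputable def linearForm {r : ℕ} (v : Fin r → Functional) (A : Fin r → ℂ[X]) : Functional :=
  ∑ i, polyMul (A i) (v i)

/-- `A` is a vector of type I multiple orthogonal polynomials for the system `v` and the
multi-index `n`: `deg A_i ≤ n_i - 1` (so `A_i = 0` if `n_i = 0`), and the linear form
`q = ∑ i, A_i v_i` satisfies `⟨q, x^m⟩ = 0` for `0 ≤ m ≤ |n| - 2` and `⟨q, x^m⟩ = 1` for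
`m = |n| - 1`. -/
structure IsTypeI {r : ℕ} (v : Fin r → Functional) (n : Fin r → ℕ) (A : Fin r → ℂ[X]) :
    Prop where
  degree_lt : ∀ i, (A i).degree < (n i : WithBot ℕ)
  orthogonal : ∀ m : ℕ, m + 2 ≤ ∑ i, n i → linearForm v A (Polynomial.X ^ m) = 0
  normalized : ∀ m : ℕ, m + 1 = ∑ i, n i → linearForm v A (Polynomial.X ^ m) = 1

/-- The multi-index of norm `n` on the step-line of `ℕ^r`: if `n = r k + j` with
`0 ≤ j ≤ r - 1`, its first `j` entries are `k + 1` and the others are `k`. -/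
def stepLine (r n : ℕ) (i : Fin r) : ℕ :=
  n / r + if (i : ℕ) < n % r then 1 else 0

/-- All the multiple orthogonal polynomials, of both types, on the step-line with respect to
the system `v` exist and are unique. -/
def StepLineExistsUnique {r : ℕ} (v : Fin r → Functional) : Prop :=
  ∀ n : ℕ, (∃! P : ℂ[X], IsTypeII v (stepLine r n) P) ∧
    (∃! A : Fin r → ℂ[X], IsTypeI v (stepLine r n) A)

/-- The monic polynomial sequence `P` (with `deg P_n = n`) is `r`-orthogonal with respect to
the system `v`. The functionals are numbered from `0`, so that `v i` is the `(i+1)`-st one. -/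
structure IsROrthogonal {r : ℕ} (v : Fin r → Functional) (P : ℕ → ℂ[X]) : Prop where
  monic : ∀ n, (P n).Monic
  natDegree_eq : ∀ n, (P n).natDegree = n
  ne_zero : ∀ (i : Fin r) (k n : ℕ), n = r * k + i → v i (Polynomial.X ^ k * P n) ≠ 0
  eq_zero : ∀ (i : Fin r) (k n : ℕ), r * k + i + 1 ≤ n → v i (Polynomial.X ^ k * P n) = 0

/-- A polynomial sequence is `(r+1)`-fold symmetric if `P_n(ω x) = ω^n P_n(x)` with
`ω = exp (2πi/(r+1))`. -/
def IsFoldSymmetric (r : ℕ) (P : ℕ → ℂ[X]) : Prop :=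
  ∀ (n : ℕ) (x : ℂ),
    (P n).eval (Complex.exp (2 * Real.pi * Complex.I / (r + 1)) * x) =
      Complex.exp (2 * n * Real.pi * Complex.I / (r + 1)) * (P n).eval x

/-- The system `V^[j] = (v_{j+1}, …, v_r, x v_1, …, x v_j)`, for `0 ≤ j ≤ r`, obtained from
`(v_1, …, v_r)`; in the code `v_{i+1}` is `v i`. -/
noncomputable def shiftedSystem {r : ℕ} (v : Fin r → Functional) (j : Fin (r + 1)) :
    Fin r → Functional :=
  fun i => if h : (j : ℕ) + i < r then v ⟨j + i, h⟩
    else polyMul Polynomial.X (v ⟨j + i - r, by omega⟩)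

/-- The power series `g_k` have constant term `1`, `g_0 = 1`, the series `g_1, …, g_r` are the
moment generating functions of `v_1, …, v_r`, and `g_{k+1} - g_k = α_k t g_{k+r+1}` with
`α_k ≠ 0` for all `k`. -/
structure IsSeriesSolution {r : ℕ} (v : Fin r → Functional) (g : ℕ → PowerSeries ℂ)
    (α : ℕ → ℂ) : Prop where
  constantCoeff_eq : ∀ k, PowerSeries.constantCoeff (g k) = 1
  zero_eq : g 0 = 1
  moments : ∀ i : Fin r, g (i + 1) = PowerSeries.mk fun n => v i (Polynomial.X ^ n)
  recurrence : ∀ k, g (k + 1) - g k = PowerSeries.C (α k) * PowerSeries.X * g (k + r + 1)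
  alpha_ne_zero : ∀ k, α k ≠ 0

/-- `P_j = x^j` for `0 ≤ j ≤ r` and `P_{n+r+1} = x P_{n+r} - α_n P_n` for all `n`. -/
structure SatisfiesRecurrence (r : ℕ) (α : ℕ → ℂ) (P : ℕ → ℂ[X]) : Prop where
  initial : ∀ j, j ≤ r → P j = Polynomial.X ^ j
  recurrence : ∀ n, P (n + r + 1) = Polynomial.X * P (n + r) - Polynomial.C (α n) * P n

end MOP

namespace MOP

open Polynomial Finset

/-! ### The step-line -/

/-! List `v_1, …, v_r, x v_1, …, x v_r, x^2 v_1, …` as `f_0, f_1, …` (`enum`). The step-line of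
`V^[j]` runs through this same list from `f_j` on, so every orthogonality condition concerns one
index, and `x f_a = f_{a+r}`.

From series to orthogonality: let `u_k` have moment generating function `s^k g_{k+1}(s^{r+1})`
(`unfolded`). The relations between the `g_k` become `x u_0 = α_0 u_r` and `x u_{k+1} = u_k +
α_{k+1} u_{k+r+1}`, the transpose of the recurrence for `P_n`; hence `⟨u_k, P_n⟩ = δ_{kn}`
(`unfolded_apply`). Restricting `u_{(r+1)m+j}` to `x^j f(x^{r+1})` gives functionals `q^[j]_m`
(`folded`) dual to the components of `P`. The same relations show that `q^[j]_m` is a combination of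
`f_j, …, f_{j+m}` with nonzero last coefficient (`hasLead_folded`). It is therefore the type I form,
and this triangular duality makes the components orthogonal (`orthogonal_of_dual`).

From orthogonality to series: `q^[j+1]_m - q^[j]_m` and `x q^[0]_{m+1} - q^[r]_m` vanish on all
powers below `x^{m+1}` and have the right span and nonzero lead, so they are nonzero multiples of
`q^[j]_{m+1}` and `q^[r]_{m+1}` (`exists_alpha`). The multipliers are the `α_k`, and the shifted
moments of the forms give the `g_k`. -/

/-- The functional `x^k V_i` has position `r * k + i` on the step-line; this turns conditions on
pairs `(i, k)` into conditions on one index below `n`. -/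
theorem lt_stepLine_iff {r n k : ℕ} (i : Fin r) : k < stepLine r n i ↔ r * k + i < n := by
  have hn := Nat.div_add_mod n r
  have hm : n % r < r := Nat.mod_lt _ (Nat.zero_lt_of_lt i.2)
  have hi := i.2
  unfold stepLine
  generalize n / r = q at *
  generalize n % r = s at *
  rcases lt_trichotomy k q with h | h | h
  · have : r * (k + 1) ≤ r * q := Nat.mul_le_mul_left r h
    rw [mul_add] at this
    constructor
    · intro; omega
    · intro; omega
  · subst h
    split_ifs <;> constructor <;> intro <;> omega
  · have : r * (q + 1) ≤ r * k := Nat.mul_le_mul_left r h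
    rw [mul_add] at this
    split_ifs <;> constructor <;> intro <;> omega

theorem sum_range_stepLine {M : Type*} [AddCommMonoid M] {r : ℕ} (hr : 1 ≤ r) (n : ℕ)
    (G : ℕ → M) :
    ∑ i : Fin r, ∑ k ∈ range (stepLine r n i), G (r * k + i) = ∑ a ∈ range n, G a := by
  rw [sum_sigma']
  refine sum_bij' (fun x _ => r * x.2 + x.1) (fun a _ => ⟨⟨a % r, Nat.mod_lt _ hr⟩, a / r⟩)
    ?_ ?_ ?_ ?_ ?_
  · rintro ⟨i, k⟩ h
    simpa [lt_stepLine_iff] using h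
  · intro a h
    simpa [lt_stepLine_iff, Nat.div_add_mod] using h
  · rintro ⟨i, k⟩ _
    have h1 : (r * k + i) % r = i := by
      rw [Nat.mul_add_mod, Nat.mod_eq_of_lt i.2]
    have h2 : (r * k + i) / r = k := by
      rw [Nat.mul_add_div hr, Nat.div_eq_of_lt i.2, add_zero]
    simp [h1, h2]
  · intro a _
    exact Nat.div_add_mod a r
  · intros
    rfl

theorem sum_stepLine {r : ℕ} (hr : 1 ≤ r) (n : ℕ) : ∑ i, stepLine r n i = n := by
  simpa using sum_range_stepLine hr n (fun _ => (1 : ℕ))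

/-! ### Functionals -/

@[simp]
theorem polyMul_apply (A : ℂ[X]) (v : Functional) (p : ℂ[X]) : polyMul A v p = v (A * p) := rfl

theorem linearForm_apply {r : ℕ} (v : Fin r → Functional) (A : Fin r → ℂ[X]) (p : ℂ[X]) :
    linearForm v A p = ∑ i, v i (A i * p) := by
  simp [linearForm]

theorem functional_ext {v w : Functional} (h : ∀ n : ℕ, v (X ^ n) = w (X ^ n)) : v = w := by
  refine Polynomial.lhom_ext' fun n => LinearMap.ext_ring ?_
  simpa [monomial_one_right_eq_X_pow] using h n

theorem functional_C_mul (v : Functional) (c : ℂ) (p : ℂ[X]) : v (C c * p) = c * v p := by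
  rw [← smul_eq_C_mul, map_smul, smul_eq_mul]

/-- A functional that vanishes on the monomials of degree less than `n` vanishes on the
polynomials of degree less than `n`. -/
theorem functional_eq_zero_of_degree_lt {w : Functional} {n : ℕ} (h : ∀ b < n, w (X ^ b) = 0)
    {p : ℂ[X]} (hp : p.degree < n) : w p = 0 := by
  by_cases h0 : p = 0
  · simp [h0]
  rw [p.as_sum_range_C_mul_X_pow, map_sum]
  refine sum_eq_zero fun i hi => ?_
  rw [functional_C_mul, h i, mul_zero]
  have := (natDegree_lt_iff_degree_lt h0).2 hp
  have := mem_range.1 hi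
  omega

theorem functional_eq_leadingCoeff {w : Functional} {n : ℕ} (h : ∀ b < n, w (X ^ b) = 0)
    (h1 : w (X ^ n) = 1) {p : ℂ[X]} (hp : p.natDegree = n) : w p = p.leadingCoeff := by
  conv_lhs => rw [p.as_sum_range_C_mul_X_pow]
  rw [map_sum, hp, sum_range_succ, sum_eq_zero, zero_add, functional_C_mul, h1, mul_one,
    leadingCoeff, hp]
  · intro i hi
    rw [functional_C_mul, h i (mem_range.1 hi), mul_zero]

/-- `f` lists the functionals `x^k V_i` in the order in which they enter on the step-line. -/
def IsEnumeration {r : ℕ} (V : Fin r → Functional) (f : ℕ → Functional) : Prop :=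
  ∀ (i : Fin r) (k : ℕ) (p : ℂ[X]), V i (X ^ k * p) = f (r * k + i) p

/-- The step-line vector of polynomials with prescribed coefficients. -/
noncomputable def ofCoeff (r n : ℕ) (y : ℕ → ℂ) (i : Fin r) : ℂ[X] :=
  ∑ k ∈ range (stepLine r n i), C (y (r * k + i)) * X ^ k

theorem coeff_ofCoeff {r n : ℕ} (y : ℕ → ℂ) (i : Fin r) (k : ℕ) :
    (ofCoeff r n y i).coeff k = if r * k + i < n then y (r * k + i) else 0 := by
  simp [ofCoeff, lt_stepLine_iff]

theorem degree_ofCoeff_lt {r n : ℕ} (y : ℕ → ℂ) (i : Fin r) :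
    (ofCoeff r n y i).degree < (stepLine r n i : WithBot ℕ) := by
  rw [degree_lt_iff_coeff_zero]
  intro k hk
  rw [coeff_ofCoeff, if_neg]
  rw [← lt_stepLine_iff]
  omega

theorem exists_eq_ofCoeff {r n : ℕ} {A : Fin r → ℂ[X]}
    (hA : ∀ i, (A i).degree < (stepLine r n i : WithBot ℕ)) : ∃ y, A = ofCoeff r n y := by
  rcases Nat.eq_zero_or_pos r with rfl | hr
  · exact ⟨0, Subsingleton.elim _ _⟩
  refine ⟨fun a => (A ⟨a % r, Nat.mod_lt _ hr⟩).coeff (a / r), funext fun i => ?_⟩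
  ext k
  have h1 : (r * k + i) % r = i := by
    rw [Nat.mul_add_mod, Nat.mod_eq_of_lt i.2]
  have h2 : (r * k + i) / r = k := by
    rw [Nat.mul_add_div hr, Nat.div_eq_of_lt i.2, add_zero]
  rw [coeff_ofCoeff]
  simp only [h1, h2]
  split_ifs with h
  · rfl
  · rw [← lt_stepLine_iff, not_lt] at h
    exact (degree_lt_iff_coeff_zero _ _).1 (hA i) k h

theorem linearForm_ofCoeff {r : ℕ} (hr : 1 ≤ r) {V : Fin r → Functional} {f : ℕ → Functional}
    (hf : IsEnumeration V f) (n : ℕ) (y : ℕ → ℂ) :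
    linearForm V (ofCoeff r n y) = ∑ a ∈ range n, y a • f a := by
  refine LinearMap.ext fun p => ?_
  rw [← sum_range_stepLine hr n (fun a => y a • f a)]
  simp only [linearForm_apply, ofCoeff, sum_mul, map_sum, mul_assoc, functional_C_mul,
    LinearMap.sum_apply, LinearMap.smul_apply, smul_eq_mul]
  exact sum_congr rfl fun i _ => sum_congr rfl fun k _ => by rw [hf i k p]

theorem isTypeI_ofCoeff_iff {r : ℕ} (hr : 1 ≤ r) {V : Fin r → Functional}
    {f : ℕ → Functional} (hf : IsEnumeration V f) (n : ℕ) (y : ℕ → ℂ) :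
    IsTypeI V (stepLine r n) (ofCoeff r n y) ↔
      (∀ m, m + 2 ≤ n → (∑ a ∈ range n, y a • f a) (X ^ m) = 0) ∧
        ∀ m, m + 1 = n → (∑ a ∈ range n, y a • f a) (X ^ m) = 1 := by
  constructor
  · rintro ⟨_, h1, h2⟩
    rw [linearForm_ofCoeff hr hf, sum_stepLine hr] at h1 h2
    exact ⟨h1, h2⟩
  · rintro ⟨h1, h2⟩
    refine ⟨degree_ofCoeff_lt y, ?_, ?_⟩
    · rwa [linearForm_ofCoeff hr hf, sum_stepLine hr]
    · rwa [linearForm_ofCoeff hr hf, sum_stepLine hr]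

theorem isTypeII_iff {r : ℕ} (hr : 1 ≤ r) {V : Fin r → Functional}
    {f : ℕ → Functional} (hf : IsEnumeration V f) (n : ℕ) (P : ℂ[X]) :
    IsTypeII V (stepLine r n) P ↔ P.Monic ∧ P.natDegree = n ∧ ∀ a < n, f a P = 0 := by
  constructor
  · rintro ⟨h1, h2, h3⟩
    refine ⟨h1, h2.trans (sum_stepLine hr n), fun a ha => ?_⟩
    have := h3 ⟨a % r, Nat.mod_lt _ hr⟩ (a / r)
    rw [lt_stepLine_iff, hf] at this
    simp only [Nat.div_add_mod] at this
    exact this ha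
  · rintro ⟨h1, h2, h3⟩
    refine ⟨h1, h2.trans (sum_stepLine hr n).symm, fun i k hk => ?_⟩
    rw [hf]
    exact h3 _ ((lt_stepLine_iff i).1 hk)

theorem isROrthogonal_iff {r : ℕ} (hr : 1 ≤ r) {V : Fin r → Functional}
    {f : ℕ → Functional} (hf : IsEnumeration V f) (Q : ℕ → ℂ[X]) :
    IsROrthogonal V Q ↔ (∀ n, (Q n).Monic ∧ (Q n).natDegree = n ∧ ∀ a < n, f a (Q n) = 0) ∧
      ∀ n, f n (Q n) ≠ 0 := by
  constructor
  · rintro ⟨h1, h2, h3, h4⟩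
    refine ⟨fun n => ⟨h1 n, h2 n, fun a ha => ?_⟩, fun n => ?_⟩
    · have := h4 ⟨a % r, Nat.mod_lt _ hr⟩ (a / r) n
      rw [hf] at this
      simp only [Nat.div_add_mod] at this
      exact this ha
    · have := h3 ⟨n % r, Nat.mod_lt _ hr⟩ (n / r) n
      rw [hf] at this
      simp only [Nat.div_add_mod] at this
      exact this trivial
  · rintro ⟨h1, h2⟩
    refine ⟨fun n => (h1 n).1, fun n => (h1 n).2.1, fun i k n h => ?_, fun i k n h => ?_⟩
    · rw [hf, ← h]
      exact h2 n
    · rw [hf]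
      exact (h1 n).2.2 _ h

/-! ### Nondegenerate sequences of functionals -/

/-- All the leading principal minors of the moment matrix of `f` are nonzero. -/
def Nondegenerate (f : ℕ → Functional) : Prop :=
  ∀ (n : ℕ) (y : ℕ → ℂ), (∀ b < n, (∑ a ∈ range n, y a • f a) (X ^ b) = 0) →
    ∀ a < n, y a = 0

/-- `w` is a linear combination of `f_0, …, f_m` in which `f_m` has a nonzero coefficient. -/
def HasLead (f : ℕ → Functional) (m : ℕ) (w : Functional) : Prop :=
  ∃ c : ℕ → ℂ, c m ≠ 0 ∧ w = ∑ a ∈ range (m + 1), c a • f a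

/-- `w` is a combination of `f_0, …, f_m` with nonzero last coefficient, it vanishes on the
powers of `x` below `x^m`, and it takes the value `1` at `x^m`. -/
structure IsTypeIForm (f : ℕ → Functional) (m : ℕ) (w : Functional) : Prop where
  lead : HasLead f m w
  orthogonal : ∀ b < m, w (X ^ b) = 0
  normalized : w (X ^ m) = 1

theorem hasLead_zero (f : ℕ → Functional) : HasLead f 0 (f 0) :=
  ⟨fun _ => 1, one_ne_zero, by simp⟩

theorem HasLead.smul {f : ℕ → Functional} {m : ℕ} {w : Functional} (h : HasLead f m w) {α : ℂ}
    (hα : α ≠ 0) : HasLead f m (α • w) := by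
  obtain ⟨c, hc, rfl⟩ := h
  exact ⟨fun a => α * c a, mul_ne_zero hα hc, by simp [smul_sum, mul_smul]⟩

theorem HasLead.of_shift {f : ℕ → Functional} {m : ℕ} {w : Functional}
    (h : HasLead (fun a => f (a + 1)) m w) : HasLead f (m + 1) w := by
  obtain ⟨c, hc, rfl⟩ := h
  exact ⟨fun a => if a = 0 then 0 else c (a - 1), by simpa using hc,
    by simp [sum_range_succ' _ (m + 1)]⟩

theorem HasLead.sub {f : ℕ → Functional} {m : ℕ} {w w' : Functional}
    (h : HasLead f (m + 1) w) (h' : HasLead f m w') : HasLead f (m + 1) (w - w') := by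
  obtain ⟨c, hc, rfl⟩ := h
  obtain ⟨d, -, rfl⟩ := h'
  refine ⟨fun a => c a - if a < m + 1 then d a else 0, by simpa using hc, ?_⟩
  simp only [sub_smul, sum_sub_distrib]
  congr 1
  rw [sum_range_succ _ (m + 1)]
  simp only [lt_irrefl, if_false, zero_smul, add_zero]
  exact sum_congr rfl fun a ha => by rw [if_pos (mem_range.1 ha)]

theorem HasLead.polyMul {f f' : ℕ → Functional} {m : ℕ} {w : Functional} (h : HasLead f m w)
    (p : ℂ[X]) (hf : ∀ a, polyMul p (f a) = f' a) : HasLead f' m (polyMul p w) := by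
  obtain ⟨c, hc, rfl⟩ := h
  refine ⟨c, hc, LinearMap.ext fun q => ?_⟩
  simp [← hf]

/-- In the span of `f_0, …, f_n`, the functionals that vanish on the polynomials of degree less
than `n` are the multiples of the type I form. -/
theorem IsTypeIForm.exists_eq_smul {f : ℕ → Functional} (hf : Nondegenerate f) {n : ℕ}
    {w D : Functional} (hw : IsTypeIForm f n w) (hD : HasLead f n D)
    (h : ∀ b < n, D (X ^ b) = 0) : ∃ α : ℂ, α ≠ 0 ∧ D = α • w := by
  obtain ⟨⟨c, -, rfl⟩, h0, h1⟩ := hw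
  obtain ⟨d, hd, rfl⟩ := hD
  set α := (∑ a ∈ range (n + 1), d a • f a) (X ^ n) with hα
  have key := hf (n + 1) (fun a => d a - α * c a) (fun b hb => by
    simp only [sub_smul, sum_sub_distrib, mul_smul, ← smul_sum]
    rw [LinearMap.sub_apply, LinearMap.smul_apply]
    rcases Nat.lt_succ_iff_lt_or_eq.1 hb with hb | rfl
    · rw [h b hb, h0 b hb, smul_zero, sub_zero]
    · rw [h1, ← hα, smul_eq_mul, mul_one, sub_self])
  refine ⟨α, fun h0 => hd ?_, ?_⟩
  · simpa [h0] using key n (Nat.lt_succ_self n)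
  · rw [smul_sum]
    refine sum_congr rfl fun a ha => ?_
    rw [sub_eq_zero.1 (key a (mem_range.1 ha)), mul_smul]

/-- Testing a vanishing combination on `R n` kills every term but the last, so the coefficients are
removed from the top down. -/
theorem Nondegenerate.of_orthogonal {f : ℕ → Functional} {R : ℕ → ℂ[X]}
    (hR : ∀ n, (R n).natDegree = n) (h0 : ∀ n, ∀ a < n, f a (R n) = 0)
    (h1 : ∀ n, f n (R n) ≠ 0) : Nondegenerate f := by
  intro n
  induction n with
  | zero => intro y _ a ha; omega
  | succ n ih =>
    intro y hy
    have hn : y n = 0 := by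
      have := functional_eq_zero_of_degree_lt hy (p := R n) (by
        refine lt_of_le_of_lt degree_le_natDegree ?_
        rw [hR]
        exact_mod_cast Nat.lt_succ_self n)
      rw [sum_range_succ, LinearMap.add_apply, LinearMap.sum_apply, sum_eq_zero, zero_add,
        LinearMap.smul_apply, smul_eq_mul, mul_eq_zero] at this
      · exact this.resolve_right (h1 n)
      · intro a ha
        rw [LinearMap.smul_apply, h0 n a (mem_range.1 ha), smul_zero]
    intro a ha
    rcases Nat.lt_succ_iff_lt_or_eq.1 ha with ha | rfl
    · refine ih y (fun b hb => ?_) a ha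
      have := hy b (by omega)
      rwa [sum_range_succ, hn, zero_smul, add_zero] at this
    · exact hn

/-- For `D` of degree `d`, the form `w d` reads off the leading coefficient of `D`, yet it is a
combination of `f_0, …, f_d`, all of which kill `D`. -/
theorem eq_zero_of_typeIForm {f w : ℕ → Functional} (hw : ∀ m, IsTypeIForm f m (w m)) {n : ℕ}
    {D : ℂ[X]} (hD : D.degree < n) (h : ∀ a < n, f a D = 0) : D = 0 := by
  by_contra h0
  have hd := (natDegree_lt_iff_degree_lt h0).2 hD
  have h1 := functional_eq_leadingCoeff (hw D.natDegree).orthogonal (hw D.natDegree).normalized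
    (p := D) rfl
  obtain ⟨c, -, hc⟩ := (hw D.natDegree).lead
  rw [hc, LinearMap.sum_apply, sum_eq_zero] at h1
  · exact h0 (leadingCoeff_eq_zero.1 h1.symm)
  · intro a ha
    rw [LinearMap.smul_apply, h a (by have := mem_range.1 ha; omega), smul_zero]

theorem eq_of_orthogonal {f w : ℕ → Functional} (hw : ∀ m, IsTypeIForm f m (w m)) {n : ℕ}
    {P Q : ℂ[X]} (hP : P.Monic ∧ P.natDegree = n ∧ ∀ a < n, f a P = 0)
    (hQ : Q.Monic ∧ Q.natDegree = n ∧ ∀ a < n, f a Q = 0) : P = Q := by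
  obtain ⟨hP1, hP2, hP3⟩ := hP
  obtain ⟨hQ1, hQ2, hQ3⟩ := hQ
  refine sub_eq_zero.1 (eq_zero_of_typeIForm hw (n := n) ?_ fun a ha => ?_)
  · have h := degree_sub_lt_left (p := P) (q := Q)
      (by rw [degree_eq_natDegree hP1.ne_zero, degree_eq_natDegree hQ1.ne_zero, hP2, hQ2])
      hP1.ne_zero (by rw [hP1.leadingCoeff, hQ1.leadingCoeff])
    rwa [degree_eq_natDegree hP1.ne_zero, hP2] at h
  · rw [map_sub, hP3 a ha, hQ3 a ha, sub_zero]

/-- Polynomials that are dual to the type I forms are `r`-orthogonal. -/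
theorem orthogonal_of_dual {f w : ℕ → Functional} (hw : ∀ m, HasLead f m (w m))
    {R : ℕ → ℂ[X]} (h : ∀ m n, w m (R n) = if m = n then 1 else 0) :
    (∀ n, ∀ a < n, f a (R n) = 0) ∧ ∀ n, f n (R n) ≠ 0 := by
  -- The expansion of `w a` in the `f_b` is triangular with nonzero diagonal, so by induction on `a`
  -- only the term `f a` survives on `R n` for `n ≥ a`.
  have key : ∀ a, (∀ n, a < n → f a (R n) = 0) ∧ f a (R a) ≠ 0 := by
    intro a
    induction a using Nat.strong_induction_on with
    | _ a ih =>
      obtain ⟨c, hc, hs⟩ := hw a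
      have hsum : ∀ n, a ≤ n → w a (R n) = c a * f a (R n) := by
        intro n hn
        rw [hs, sum_range_succ, LinearMap.add_apply, LinearMap.sum_apply, sum_eq_zero, zero_add,
          LinearMap.smul_apply, smul_eq_mul]
        intro b hb
        have hb := mem_range.1 hb
        rw [LinearMap.smul_apply, (ih b hb).1 n (by omega), smul_zero]
      constructor
      · intro n hn
        have := hsum n hn.le
        rw [h, if_neg hn.ne, zero_eq_mul] at this
        exact this.resolve_left hc
      · intro h0
        have := hsum a le_rfl
        rw [h, if_pos rfl, h0, mul_zero] at this
        exact one_ne_zero this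
  exact ⟨fun n a ha => (key a).1 n ha, fun n => (key n).2⟩

theorem IsTypeIForm.existsUnique_isTypeI {r : ℕ} (hr : 1 ≤ r) {V : Fin r → Functional}
    {f : ℕ → Functional} (hf : IsEnumeration V f) (hn : Nondegenerate f) {m : ℕ}
    {w : Functional} (hw : IsTypeIForm f m w) :
    (∃! A, IsTypeI V (stepLine r (m + 1)) A) ∧
      ∀ A, IsTypeI V (stepLine r (m + 1)) A → linearForm V A = w := by
  obtain ⟨⟨c, -, rfl⟩, h0, h1⟩ := hw
  have hex : IsTypeI V (stepLine r (m + 1)) (ofCoeff r (m + 1) c) := by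
    rw [isTypeI_ofCoeff_iff hr hf]
    refine ⟨fun b hb => h0 b (by omega), fun b hb => ?_⟩
    obtain rfl : b = m := by omega
    exact h1
  have huniq : ∀ A, IsTypeI V (stepLine r (m + 1)) A → A = ofCoeff r (m + 1) c := by
    intro A hA
    obtain ⟨y, rfl⟩ := exists_eq_ofCoeff hA.degree_lt
    obtain ⟨hy0, hy1⟩ := (isTypeI_ofCoeff_iff hr hf _ _).1 hA
    have key := hn (m + 1) (fun a => y a - c a) (fun b hb => by
      simp only [sub_smul, sum_sub_distrib]
      rw [LinearMap.sub_apply]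
      rcases Nat.lt_succ_iff_lt_or_eq.1 hb with hb | rfl
      · rw [hy0 b (by omega), h0 b hb, sub_zero]
      · rw [hy1 b rfl, h1, sub_self])
    funext i
    ext k
    rw [coeff_ofCoeff, coeff_ofCoeff]
    split_ifs with h
    · exact sub_eq_zero.1 (key _ h)
    · rfl
  refine ⟨⟨_, hex, huniq⟩, fun A hA => ?_⟩
  rw [huniq A hA, linearForm_ofCoeff hr hf]

theorem stepLineExistsUnique_of_typeIForm {r : ℕ} (hr : 1 ≤ r) {V : Fin r → Functional}
    {f w : ℕ → Functional} (hf : IsEnumeration V f) (hn : Nondegenerate f)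
    (hw : ∀ m, IsTypeIForm f m (w m)) {R : ℕ → ℂ[X]}
    (hR : ∀ n, (R n).Monic ∧ (R n).natDegree = n ∧ ∀ a < n, f a (R n) = 0) :
    StepLineExistsUnique V := by
  intro n
  constructor
  · refine ⟨R n, (isTypeII_iff hr hf n _).2 (hR n), fun P hP => ?_⟩
    exact eq_of_orthogonal hw ((isTypeII_iff hr hf n _).1 hP) (hR n)
  · cases n with
    | zero =>
      -- For norm `0` both moment conditions are vacuous and the degree bounds force every entry to
      -- be `0`.
      refine ⟨ofCoeff r 0 0, (isTypeI_ofCoeff_iff hr hf _ _).2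
        ⟨fun m hm => by omega, fun m hm => by omega⟩, fun A hA => ?_⟩
      obtain ⟨y, rfl⟩ := exists_eq_ofCoeff hA.degree_lt
      funext i
      ext k
      simp [coeff_ofCoeff]
    | succ m => exact ((hw m).existsUnique_isTypeI hr hf hn).1

/-- A combination killing `x^b` for all `b < n` can be added to a type I vector without spoiling it;
uniqueness makes it trivial. -/
theorem StepLineExistsUnique.nondegenerate {r : ℕ} (hr : 1 ≤ r) {V : Fin r → Functional}
    {f : ℕ → Functional} (hf : IsEnumeration V f) (h : StepLineExistsUnique V) :
    Nondegenerate f := by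
  intro n y hy a ha
  obtain ⟨A, hA, huniq⟩ := (h n).2
  obtain ⟨z, rfl⟩ := exists_eq_ofCoeff hA.degree_lt
  obtain ⟨h0, h1⟩ := (isTypeI_ofCoeff_iff hr hf _ _).1 hA
  have h2 : IsTypeI V (stepLine r n) (ofCoeff r n fun a => z a + y a) := by
    rw [isTypeI_ofCoeff_iff hr hf]
    simp only [add_smul, sum_add_distrib]
    constructor
    · intro m hm
      rw [LinearMap.add_apply, h0 m hm, hy m (by omega), add_zero]
    · intro m hm
      rw [LinearMap.add_apply, h1 m hm, hy m (by omega), add_zero]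
  have h3 := congrArg (fun p => p.coeff (a / r)) (congrFun (huniq _ h2) ⟨a % r, Nat.mod_lt _ hr⟩)
  simp only [coeff_ofCoeff, Nat.div_add_mod, if_pos ha] at h3
  simpa using h3

theorem StepLineExistsUnique.exists_typeIForm {r : ℕ} (hr : 1 ≤ r) {V : Fin r → Functional}
    {f : ℕ → Functional} (hf : IsEnumeration V f) (h : StepLineExistsUnique V) (m : ℕ) :
    ∃ w, IsTypeIForm f m w := by
  have hn := h.nondegenerate hr hf
  obtain ⟨A, hA, -⟩ := (h (m + 1)).2
  obtain ⟨c, rfl⟩ := exists_eq_ofCoeff hA.degree_lt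
  obtain ⟨h0, h1⟩ := (isTypeI_ofCoeff_iff hr hf _ _).1 hA
  -- If the last coefficient vanished, the form would be a combination of `f_0, …, f_{m-1}` killing
  -- all powers below `x^m`, hence zero, against its value `1` at `x^m`.
  refine ⟨_, ⟨c, fun hc => ?_, rfl⟩, fun b hb => h0 b (by omega), h1 m rfl⟩
  rw [sum_range_succ, hc, zero_smul, add_zero] at h0 h1
  have hz := hn m c (fun b hb => h0 b (by omega))
  have := h1 m rfl
  rw [sum_eq_zero] at this
  · simp at this
  · intro a ha
    rw [hz a (mem_range.1 ha), zero_smul]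

/-! ### The functionals attached to a system -/

/-- The functionals `v_1, …, v_r, x v_1, …, x v_r, x^2 v_1, …`. -/
noncomputable def enum {r : ℕ} (hr : 1 ≤ r) (v : Fin r → Functional) (a : ℕ) : Functional :=
  polyMul (X ^ (a / r)) (v ⟨a % r, Nat.mod_lt _ hr⟩)

theorem enum_of_lt {r : ℕ} (hr : 1 ≤ r) (v : Fin r → Functional) {j : ℕ} (hj : j < r) :
    enum hr v j = v ⟨j, hj⟩ := by
  refine LinearMap.ext fun p => ?_
  simp [enum, Nat.div_eq_of_lt hj, Nat.mod_eq_of_lt hj]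

/-- This closes the cycle of shifted systems: multiplication by `x` carries the list for `V^[0]` to
the list for `V^[r]`. -/
theorem polyMul_X_enum {r : ℕ} (hr : 1 ≤ r) (v : Fin r → Functional) (a : ℕ) :
    polyMul X (enum hr v a) = enum hr v (a + r) := by
  refine LinearMap.ext fun p => ?_
  simp only [enum, polyMul_apply, Nat.add_mod_right, Nat.add_div_right a hr, pow_succ, mul_assoc]

theorem isEnumeration_enum {r : ℕ} (hr : 1 ≤ r) (v : Fin r → Functional) :
    IsEnumeration v (enum hr v) := by
  intro i k p
  have h1 : (r * k + i) % r = i := by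
    rw [Nat.mul_add_mod, Nat.mod_eq_of_lt i.2]
  have h2 : (r * k + i) / r = k := by
    rw [Nat.mul_add_div hr, Nat.div_eq_of_lt i.2, add_zero]
  simp only [enum, polyMul_apply, h1, h2]

theorem isEnumeration_shiftedSystem {r : ℕ} (hr : 1 ≤ r) (v : Fin r → Functional)
    (j : Fin (r + 1)) : IsEnumeration (shiftedSystem v j) fun a => enum hr v (a + j) := by
  intro i k p
  unfold shiftedSystem
  have hi := i.2
  have hj := j.2
  split_ifs with h
  · rw [isEnumeration_enum hr v]
    congr 2
    simp only
    ring
  · rw [polyMul_apply, ← mul_assoc, ← pow_succ', isEnumeration_enum hr v]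
    congr 2
    simp only [mul_add]
    omega

/-! ### Solutions of the recurrence for the polynomials -/

/-- The solution of `P_{n+r+1} = x P_{n+r} - α_n P_n` with `P_j = x^j` for `j ≤ r`. -/
noncomputable def recPoly (r : ℕ) (α : ℕ → ℂ) : ℕ → ℂ[X]
  | n => if _ : n ≤ r then X ^ n
    else X * recPoly r α (n - 1) - C (α (n - r - 1)) * recPoly r α (n - r - 1)
  termination_by n => n

theorem satisfiesRecurrence_recPoly (r : ℕ) (α : ℕ → ℂ) :
    SatisfiesRecurrence r α (recPoly r α) := by
  constructor
  · intro j hj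
    rw [recPoly, dif_pos hj]
  · intro n
    rw [recPoly, dif_neg (by omega)]
    congr 3 <;> congr 1 <;> omega

theorem SatisfiesRecurrence.eq {r : ℕ} {α : ℕ → ℂ} {P Q : ℕ → ℂ[X]}
    (hP : SatisfiesRecurrence r α P) (hQ : SatisfiesRecurrence r α Q) : P = Q := by
  funext n
  induction n using Nat.strong_induction_on with
  | _ n ih =>
    by_cases h : n ≤ r
    · rw [hP.initial n h, hQ.initial n h]
    · obtain ⟨m, rfl⟩ : ∃ m, n = m + r + 1 := ⟨n - r - 1, by omega⟩
      rw [hP.recurrence, hQ.recurrence, ih (m + r) (by omega), ih m (by omega)]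

theorem SatisfiesRecurrence.isFoldSymmetric {r : ℕ} {α : ℕ → ℂ} {P : ℕ → ℂ[X]}
    (hP : SatisfiesRecurrence r α P) : IsFoldSymmetric r P := by
  intro n x
  set ω := Complex.exp (2 * Real.pi * Complex.I / (r + 1)) with hω
  have hpow : ∀ n : ℕ, Complex.exp (2 * n * Real.pi * Complex.I / (r + 1)) = ω ^ n := by
    intro n
    rw [hω, ← Complex.exp_nat_mul]
    congr 1
    ring
  have h1 : ω ^ (r + 1) = 1 := by
    have hr : (r + 1 : ℂ) ≠ 0 := by exact_mod_cast Nat.succ_ne_zero r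
    rw [hω, ← Complex.exp_nat_mul]
    refine Eq.trans (congrArg Complex.exp ?_) Complex.exp_two_pi_mul_I
    push_cast
    field_simp
  rw [hpow]
  induction n using Nat.strong_induction_on with
  | _ n ih =>
    by_cases h : n ≤ r
    · simp [hP.initial n h, mul_pow]
    · obtain ⟨m, rfl⟩ : ∃ m, n = m + r + 1 := ⟨n - r - 1, by omega⟩
      simp only [hP.recurrence, eval_sub, eval_mul, eval_X, eval_C, ih (m + r) (by omega),
        ih m (by omega)]
      have h2 : ω ^ (m + r + 1) = ω ^ m := by rw [add_assoc, pow_add, h1, mul_one]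
      rw [mul_sub, ← mul_assoc, ← mul_assoc (ω ^ (m + r + 1)) x]
      congr 1
      · ring
      · rw [h2]
        ring

theorem SatisfiesRecurrence.monic {r : ℕ} {α : ℕ → ℂ} {P : ℕ → ℂ[X]}
    (hP : SatisfiesRecurrence r α P) (n : ℕ) : (P n).Monic ∧ (P n).natDegree = n := by
  induction n using Nat.strong_induction_on with
  | _ n ih =>
    by_cases h : n ≤ r
    · rw [hP.initial n h]
      exact ⟨monic_X_pow n, natDegree_X_pow n⟩
    · obtain ⟨m, rfl⟩ : ∃ m, n = m + r + 1 := ⟨n - r - 1, by omega⟩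
      rw [hP.recurrence]
      obtain ⟨h1, h2⟩ := ih (m + r) (by omega)
      obtain ⟨-, h4⟩ := ih m (by omega)
      have h5 : (X * P (m + r)).natDegree = m + r + 1 := by
        rw [natDegree_X_mul h1.ne_zero, h2]
      have h6 : (C (α m) * P m).natDegree < (X * P (m + r)).natDegree :=
        lt_of_le_of_lt (natDegree_C_mul_le _ _) (by omega)
      exact ⟨(monic_X.mul h1).sub_of_left (degree_lt_degree h6),
        (natDegree_sub_eq_left_of_natDegree_lt h6).trans h5⟩

/-- The decomposition of the symmetric sequence. -/
theorem SatisfiesRecurrence.exists_component {r : ℕ} {α : ℕ → ℂ} {P : ℕ → ℂ[X]}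
    (hP : SatisfiesRecurrence r α P) (n j : ℕ) (hj : j ≤ r) :
    ∃ R : ℂ[X], (R.Monic ∧ R.natDegree = n) ∧
      P ((r + 1) * n + j) = X ^ j * R.comp (X ^ (r + 1)) := by
  have hsub : ∀ {R S : ℂ[X]} {c : ℂ} {k : ℕ}, R.Monic ∧ R.natDegree = k + 1 →
      S.Monic ∧ S.natDegree = k → (R - C c * S).Monic ∧ (R - C c * S).natDegree = k + 1 := by
    rintro R S c k ⟨h1, h2⟩ ⟨-, h4⟩
    have h6 : (C c * S).natDegree < R.natDegree :=
      lt_of_le_of_lt (natDegree_C_mul_le _ _) (by omega)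
    exact ⟨h1.sub_of_left (degree_lt_degree h6),
        (natDegree_sub_eq_left_of_natDegree_lt h6).trans h2⟩
  induction n generalizing j with
  | zero => exact ⟨1, ⟨monic_one, natDegree_one⟩, by simp [hP.initial j hj]⟩
  | succ n ih =>
    induction j with
    | zero =>
      obtain ⟨R, hR, hRP⟩ := ih r le_rfl
      obtain ⟨S, hS, hSP⟩ := ih 0 (Nat.zero_le r)
      -- Here `x * x^r = x^{r+1}` contributes one factor of the new variable, which raises the
      -- degree; in the case `j + 1` the factor `x` only turns `x^j` into `x^{j+1}`.
      refine ⟨X * R - C (α ((r + 1) * n)) * S, hsub ⟨monic_X.mul hR.1, ?_⟩ hS, ?_⟩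
      · rw [natDegree_X_mul hR.1.ne_zero, hR.2]
      · rw [show (r + 1) * (n + 1) + 0 = (r + 1) * n + r + 1 by ring, hP.recurrence, hRP,
          ← add_zero ((r + 1) * n), hSP]
        simp only [sub_comp, mul_comp, X_comp, C_comp]
        ring
    | succ j ihj =>
      obtain ⟨R, hR, hRP⟩ := ihj (by omega)
      obtain ⟨S, hS, hSP⟩ := ih (j + 1) hj
      refine ⟨R - C (α ((r + 1) * n + (j + 1))) * S, hsub hR hS, ?_⟩
      rw [show (r + 1) * (n + 1) + (j + 1) = (r + 1) * n + (j + 1) + r + 1 by ring,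
        hP.recurrence, hSP,
        show (r + 1) * n + (j + 1) + r = (r + 1) * (n + 1) + j by ring, hRP]
      simp only [sub_comp, mul_comp, C_comp]
      ring

/-! ### Functionals dual to the symmetric sequence -/

/-- The functional whose moment generating function is `s^k g_{k+1}(s^{r+1})`. -/
noncomputable def unfolded (r : ℕ) (g : ℕ → PowerSeries ℂ) (k : ℕ) : Functional :=
  Polynomial.lsum fun n =>
    -- Natural subtraction truncates: without `k ≤ n`, the case `n < k` would count as `r + 1 ∣ 0`.
    (if k ≤ n ∧ r + 1 ∣ n - k then PowerSeries.coeff ((n - k) / (r + 1)) (g (k + 1)) else 0) •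
      LinearMap.id

theorem unfolded_X_pow (r : ℕ) (g : ℕ → PowerSeries ℂ) (k n : ℕ) :
    unfolded r g k (X ^ n) =
      if k ≤ n ∧ r + 1 ∣ n - k then PowerSeries.coeff ((n - k) / (r + 1)) (g (k + 1)) else 0 := by
  rw [unfolded, Polynomial.lsum_apply, ← monomial_one_right_eq_X_pow, sum_monomial_index]
  · simp only [LinearMap.smul_apply, LinearMap.id_apply, smul_eq_mul, mul_one]
  · exact map_zero _

theorem unfolded_X_pow_add (r : ℕ) (g : ℕ → PowerSeries ℂ) (k l : ℕ) :
    unfolded r g k (X ^ (k + (r + 1) * l)) = PowerSeries.coeff l (g (k + 1)) := by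
  rw [unfolded_X_pow, if_pos ⟨Nat.le_add_right _ _, by simp⟩]
  simp

theorem unfolded_X_pow_of_lt (r : ℕ) (g : ℕ → PowerSeries ℂ) {k n : ℕ} (h : n < k) :
    unfolded r g k (X ^ n) = 0 := by
  rw [unfolded_X_pow, if_neg (by omega)]

theorem unfolded_X_pow_of_not_dvd (r : ℕ) (g : ℕ → PowerSeries ℂ) {k n : ℕ}
    (h : ¬ r + 1 ∣ n - k) : unfolded r g k (X ^ n) = 0 := by
  rw [unfolded_X_pow, if_neg fun h' => h h'.2]

/-! ### Transposed recurrence and biorthogonality of the unfolded functionals -/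

namespace IsSeriesSolution

variable {r : ℕ} {v : Fin r → Functional} {g : ℕ → PowerSeries ℂ} {α : ℕ → ℂ}

theorem coeff_succ (h : IsSeriesSolution v g α) (k l : ℕ) :
    PowerSeries.coeff (l + 1) (g (k + 1)) =
      PowerSeries.coeff (l + 1) (g k) + α k * PowerSeries.coeff l (g (k + r + 1)) := by
  have := congrArg (PowerSeries.coeff (l + 1)) (h.recurrence k)
  rw [map_sub, mul_assoc, PowerSeries.coeff_C_mul, PowerSeries.coeff_succ_X_mul] at this
  linear_combination this

theorem coeff_zero (h : IsSeriesSolution v g α) (k : ℕ) : PowerSeries.coeff 0 (g k) = 1 := by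
  rw [PowerSeries.coeff_zero_eq_constantCoeff_apply, h.constantCoeff_eq]

/-- As `g_0 = 1` has no higher coefficients, the boundary relation has no lower neighbour. -/
theorem unfolded_zero_X_mul (h : IsSeriesSolution v g α) (p : ℂ[X]) :
    unfolded r g 0 (X * p) = α 0 * unfolded r g r p := by
  suffices polyMul X (unfolded r g 0) = α 0 • unfolded r g r by
    simpa using congrArg (fun w => w p) this
  refine functional_ext fun n => ?_
  rw [polyMul_apply, ← pow_succ', LinearMap.smul_apply, smul_eq_mul]
  by_cases hd : r + 1 ∣ n + 1
  · obtain ⟨l, hl⟩ := hd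
    cases l with
    | zero => omega
    | succ l =>
      rw [hl]
      obtain rfl : n = r + (r + 1) * l := by rw [mul_add] at hl; omega
      rw [unfolded_X_pow_add, ← zero_add ((r + 1) * (l + 1)), unfolded_X_pow_add, h.coeff_succ,
        h.zero_eq, PowerSeries.coeff_one, if_neg (Nat.succ_ne_zero l)]
      simp
  · rw [unfolded_X_pow_of_not_dvd _ _ (by simpa using hd)]
    rcases lt_or_ge n r with hn | hn
    · rw [unfolded_X_pow_of_lt _ _ hn, mul_zero]
    · rw [unfolded_X_pow_of_not_dvd, mul_zero]
      intro hd'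
      refine hd ?_
      rw [show n + 1 = n - r + (r + 1) by omega]
      exact dvd_add hd' dvd_rfl

/-- Multiplying by `x` shifts moments, that is, divides `s^{k+1} g_{k+2}(s^{r+1})` by `s`; the
recurrence for `g_{k+2}` then gives the two terms. -/
theorem unfolded_succ_X_mul (h : IsSeriesSolution v g α) (k : ℕ) (p : ℂ[X]) :
    unfolded r g (k + 1) (X * p) =
      unfolded r g k p + α (k + 1) * unfolded r g (k + 1 + r) p := by
  suffices polyMul X (unfolded r g (k + 1)) =
      unfolded r g k + α (k + 1) • unfolded r g (k + 1 + r) by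
    simpa using congrArg (fun w => w p) this
  refine functional_ext fun n => ?_
  rw [polyMul_apply, ← pow_succ', LinearMap.add_apply, LinearMap.smul_apply, smul_eq_mul]
  rcases lt_or_ge n k with hn | hn
  · rw [unfolded_X_pow_of_lt _ _ hn, unfolded_X_pow_of_lt _ _ (by omega),
      unfolded_X_pow_of_lt _ _ (by omega), mul_zero, add_zero]
  obtain ⟨m, rfl⟩ := Nat.exists_eq_add_of_le hn
  by_cases hd : r + 1 ∣ m
  · obtain ⟨l, rfl⟩ := hd
    rw [show k + (r + 1) * l + 1 = k + 1 + (r + 1) * l by ring, unfolded_X_pow_add,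
      unfolded_X_pow_add]
    cases l with
    | zero =>
      -- At the lowest power the identity is the equality of constant terms, both `1`.
      rw [unfolded_X_pow_of_lt _ _ (by omega), h.coeff_zero, h.coeff_zero, mul_zero, add_zero]
    | succ l =>
      rw [show k + (r + 1) * (l + 1) = k + 1 + r + (r + 1) * l by ring, unfolded_X_pow_add,
        h.coeff_succ]
  · rw [unfolded_X_pow_of_not_dvd _ _ (by simpa [show k + m + 1 - (k + 1) = m by omega] using hd),
      unfolded_X_pow_of_not_dvd _ _ (by simpa using hd)]
    rcases lt_or_ge (k + m) (k + 1 + r) with hn | hn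
    · rw [unfolded_X_pow_of_lt _ _ hn, mul_zero, add_zero]
    · rw [unfolded_X_pow_of_not_dvd, mul_zero, add_zero]
      intro hd'
      refine hd ?_
      rw [show m = k + m - (k + 1 + r) + (r + 1) by omega]
      exact dvd_add hd' dvd_rfl

/-- The functionals and the polynomials obey transposed recurrences with the same `α`, so the two
`α` contributions cancel. -/
theorem unfolded_apply (h : IsSeriesSolution v g α) {P : ℕ → ℂ[X]}
    (hP : SatisfiesRecurrence r α P) (k n : ℕ) :
    unfolded r g k (P n) = if k = n then 1 else 0 := by
  induction n using Nat.strong_induction_on generalizing k with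
  | _ n ih =>
    by_cases hn : n ≤ r
    · rw [hP.initial n hn]
      rcases lt_trichotomy n k with hk | rfl | hk
      · rw [unfolded_X_pow_of_lt _ _ hk, if_neg hk.ne']
      · rw [if_pos rfl, ← h.coeff_zero (n + 1), ← unfolded_X_pow_add r g n 0, mul_zero, add_zero]
      · rw [unfolded_X_pow_of_not_dvd, if_neg hk.ne]
        intro hd
        have := Nat.le_of_dvd (by omega) hd
        omega
    · obtain ⟨m, rfl⟩ : ∃ m, n = m + r + 1 := ⟨n - r - 1, by omega⟩
      rw [hP.recurrence, map_sub, functional_C_mul, ih m (by omega)]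
      cases k with
      | zero =>
        rw [h.unfolded_zero_X_mul, ih (m + r) (by omega)]
        rcases Nat.eq_zero_or_pos m with rfl | hm
        · simp
        · rw [if_neg (by omega), if_neg (by omega), if_neg (by omega)]
          simp
      | succ k =>
        rw [h.unfolded_succ_X_mul, ih (m + r) (by omega), ih (m + r) (by omega)]
        by_cases hm : k + 1 = m
        · subst hm
          rw [if_neg (by omega), if_pos (by omega), if_pos rfl, if_neg (by omega)]
          ring
        · rw [if_neg (show ¬ k + 1 + r = m + r by omega), if_neg hm]
          simp

/-- The sequence `P` is `r`-orthogonal with respect to the first `r` unfolded functionals. -/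
theorem isROrthogonal_unfolded (h : IsSeriesSolution v g α) {P : ℕ → ℂ[X]}
    (hP : SatisfiesRecurrence r α P) :
    IsROrthogonal (fun i : Fin r => unfolded r g i) P := by
  -- All `i` are needed, not only `i < r`: lowering `k` by one replaces `i` by `i + r`.
  have key : ∀ (k i : ℕ), unfolded r g i (X ^ k * P (r * k + i)) ≠ 0 ∧
      ∀ n, r * k + i < n → unfolded r g i (X ^ k * P n) = 0 := by
    intro k
    induction k with
    | zero =>
      intro i
      refine ⟨?_, fun n hn => ?_⟩
      · simp [h.unfolded_apply hP]
      · rw [pow_zero, one_mul, h.unfolded_apply hP, if_neg (by omega)]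
    | succ k ih =>
      intro i
      have hir : r * (k + 1) + i = r * k + (i + r) := by ring
      rw [hir]
      obtain ⟨ih1, ih2⟩ := ih (i + r)
      cases i with
      | zero =>
        rw [zero_add] at ih1 ih2 ⊢
        simp only [pow_succ', mul_assoc, h.unfolded_zero_X_mul]
        exact ⟨mul_ne_zero (h.alpha_ne_zero 0) ih1, fun n hn => by rw [ih2 n hn, mul_zero]⟩
      | succ i =>
        simp only [pow_succ', mul_assoc, h.unfolded_succ_X_mul]
        constructor
        · rw [(ih i).2 _ (by omega), zero_add]
          exact mul_ne_zero (h.alpha_ne_zero _) ih1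
        · intro n hn
          rw [(ih i).2 n (by omega), ih2 n hn, mul_zero, add_zero]
  exact ⟨fun n => (hP.monic n).1, fun n => (hP.monic n).2,
    fun i k n hn => hn ▸ (key k i).1, fun i k n hn => (key k i).2 n hn⟩

end IsSeriesSolution

/-- The functional `f ↦ ⟨u_{(r+1)m+j}, x^j f(x^{r+1})⟩`, where `u` are the unfolded
functionals. -/
noncomputable def folded (r : ℕ) (g : ℕ → PowerSeries ℂ) (j m : ℕ) : Functional :=
  unfolded r g ((r + 1) * m + j) ∘ₗ LinearMap.mulLeft ℂ (X ^ j) ∘ₗ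
    (aeval (X ^ (r + 1) : ℂ[X])).toLinearMap

theorem folded_apply (r : ℕ) (g : ℕ → PowerSeries ℂ) (j m : ℕ) (p : ℂ[X]) :
    folded r g j m p = unfolded r g ((r + 1) * m + j) (X ^ j * p.comp (X ^ (r + 1))) := rfl

theorem folded_X_pow (r : ℕ) (g : ℕ → PowerSeries ℂ) (j m b : ℕ) :
    folded r g j m (X ^ b) = unfolded r g ((r + 1) * m + j) (X ^ ((r + 1) * b + j)) := by
  rw [folded_apply, X_pow_comp, ← pow_mul, ← pow_add, add_comm j ((r + 1) * b)]

theorem folded_X_pow_add (r : ℕ) (g : ℕ → PowerSeries ℂ) (j m b : ℕ) :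
    folded r g j m (X ^ (b + m)) = PowerSeries.coeff b (g ((r + 1) * m + j + 1)) := by
  rw [folded_X_pow, ← unfolded_X_pow_add]
  congr 2
  ring

theorem folded_X_pow_of_lt (r : ℕ) (g : ℕ → PowerSeries ℂ) (j : ℕ) {m b : ℕ} (h : b < m) :
    folded r g j m (X ^ b) = 0 := by
  rw [folded_X_pow, unfolded_X_pow_of_lt]
  have := Nat.mul_lt_mul_of_pos_left h (Nat.succ_pos r)
  simpa using this

/-! ### Folded functionals as type I linear forms -/

namespace IsSeriesSolution

variable {r : ℕ} {v : Fin r → Functional} {g : ℕ → PowerSeries ℂ} {α : ℕ → ℂ}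

theorem folded_succ (h : IsSeriesSolution v g α) (j m : ℕ) :
    folded r g j (m + 1) =
      (α ((r + 1) * m + j + 1))⁻¹ • (folded r g (j + 1) m - folded r g j m) := by
  rw [eq_inv_smul_iff₀ (h.alpha_ne_zero _)]
  refine LinearMap.ext fun p => ?_
  simp only [LinearMap.smul_apply, LinearMap.sub_apply, folded_apply, smul_eq_mul]
  rw [pow_succ' _ j, mul_assoc X, ← add_assoc, h.unfolded_succ_X_mul,
    show (r + 1) * (m + 1) + j = (r + 1) * m + j + 1 + r by ring]
  ring

/-- For `j = r` the product `x * x^r = x^{r+1}` is the variable after folding, so the next system in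
the cycle is `V^[0]` multiplied by `x`. -/
theorem folded_last_zero (h : IsSeriesSolution v g α) :
    folded r g r 0 = (α 0)⁻¹ • polyMul X (folded r g 0 0) := by
  rw [eq_inv_smul_iff₀ (h.alpha_ne_zero _)]
  refine LinearMap.ext fun p => ?_
  simp only [LinearMap.smul_apply, polyMul_apply, folded_apply, smul_eq_mul, mul_comp, X_comp,
    mul_zero, zero_add, pow_zero, one_mul]
  rw [pow_succ' _ r, mul_assoc, h.unfolded_zero_X_mul]

theorem folded_last_succ (h : IsSeriesSolution v g α) (m : ℕ) :
    folded r g r (m + 1) = (α ((r + 1) * m + r + 1))⁻¹ •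
      (polyMul X (folded r g 0 (m + 1)) - folded r g r m) := by
  rw [eq_inv_smul_iff₀ (h.alpha_ne_zero _)]
  refine LinearMap.ext fun p => ?_
  simp only [LinearMap.smul_apply, LinearMap.sub_apply, polyMul_apply, folded_apply, smul_eq_mul,
    mul_comp, X_comp, pow_zero, one_mul]
  rw [pow_succ' _ r, mul_assoc, show (r + 1) * (m + 1) + 0 = (r + 1) * m + r + 1 by ring,
    h.unfolded_succ_X_mul, show (r + 1) * (m + 1) + r = (r + 1) * m + r + 1 + r by ring]
  ring

theorem folded_zero_right (h : IsSeriesSolution v g α) {j : ℕ} (hj : j < r) :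
    folded r g j 0 = v ⟨j, hj⟩ := by
  refine functional_ext fun n => ?_
  have h1 := folded_X_pow_add r g j 0 n
  have h2 := h.moments ⟨j, hj⟩
  rw [mul_zero, zero_add, h2, PowerSeries.coeff_mk, add_zero] at h1
  exact h1

theorem hasLead_folded (h : IsSeriesSolution v g α) (hr : 1 ≤ r) (m j : ℕ) (hj : j ≤ r) :
    HasLead (fun a => enum hr v (a + j)) m (folded r g j m) := by
  have hX : ∀ a, polyMul X (enum hr v (a + 0)) = enum hr v (a + r) := polyMul_X_enum hr v
  induction m generalizing j with
  | zero =>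
    have hlt : ∀ j < r, HasLead (fun a => enum hr v (a + j)) 0 (folded r g j 0) := by
      intro j hj
      rw [h.folded_zero_right hj, ← enum_of_lt hr v hj]
      simpa using hasLead_zero fun a => enum hr v (a + j)
    rcases hj.lt_or_eq with hj | rfl
    · exact hlt j hj
    · rw [h.folded_last_zero]
      exact ((hlt 0 hr).polyMul X hX).smul (inv_ne_zero (h.alpha_ne_zero _))
  | succ m ih =>
    -- The case `j = r` at level `m + 1` relies on `j = 0` at that same level, so the indices `j <
    -- r` are settled beforehand.
    have hlt : ∀ j < r, HasLead (fun a => enum hr v (a + j)) (m + 1) (folded r g j (m + 1)) := by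
      intro j hj
      rw [h.folded_succ]
      refine (HasLead.sub (HasLead.of_shift ?_) (ih j hj.le)).smul
        (inv_ne_zero (h.alpha_ne_zero _))
      simpa only [add_assoc, add_comm 1 j] using ih (j + 1) hj
    rcases hj.lt_or_eq with hj | rfl
    · exact hlt j hj
    · rw [h.folded_last_succ]
      exact (((hlt 0 hr).polyMul X hX).sub (ih j le_rfl)).smul
        (inv_ne_zero (h.alpha_ne_zero _))

theorem isTypeIForm_folded (h : IsSeriesSolution v g α) (hr : 1 ≤ r) {j : ℕ} (hj : j ≤ r)
    (m : ℕ) : IsTypeIForm (fun a => enum hr v (a + j)) m (folded r g j m) := by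
  refine ⟨h.hasLead_folded hr m j hj, fun b hb => folded_X_pow_of_lt r g j hb, ?_⟩
  have := folded_X_pow_add r g j m 0
  rwa [zero_add, h.coeff_zero] at this

/-- The components of the symmetric sequence are orthogonal with respect to the shifted
systems. -/
theorem exists_orthogonal_component (h : IsSeriesSolution v g α) (hr : 1 ≤ r) {P : ℕ → ℂ[X]}
    (hP : SatisfiesRecurrence r α P) {j : ℕ} (hj : j ≤ r) :
    ∃ R : ℕ → ℂ[X], (∀ n, P ((r + 1) * n + j) = X ^ j * (R n).comp (X ^ (r + 1))) ∧
      (∀ n, (R n).Monic ∧ (R n).natDegree = n ∧ ∀ a < n, enum hr v (a + j) (R n) = 0) ∧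
      ∀ n, enum hr v (n + j) (R n) ≠ 0 := by
  choose R hR hRP using fun n => hP.exists_component n j hj
  have hdual : ∀ m n, folded r g j m (R n) = if m = n then 1 else 0 := by
    intro m n
    rw [folded_apply, ← hRP, h.unfolded_apply hP]
    simp
  obtain ⟨h0, h1⟩ := orthogonal_of_dual (fun m => h.hasLead_folded hr m j hj) hdual
  exact ⟨R, hRP, fun n => ⟨(hR n).1, (hR n).2, h0 n⟩, h1⟩

theorem nondegenerate (h : IsSeriesSolution v g α) (hr : 1 ≤ r) {j : ℕ} (hj : j ≤ r) :
    Nondegenerate fun a => enum hr v (a + j) := by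
  obtain ⟨R, -, hR, hR'⟩ :=
    h.exists_orthogonal_component hr (satisfiesRecurrence_recPoly r α) hj
  exact Nondegenerate.of_orthogonal (fun n => (hR n).2.1) (fun n => (hR n).2.2) hR'

theorem stepLineExistsUnique (h : IsSeriesSolution v g α) (hr : 1 ≤ r) (j : Fin (r + 1)) :
    StepLineExistsUnique (shiftedSystem v j) := by
  have hj : (j : ℕ) ≤ r := Nat.lt_succ_iff.1 j.2
  obtain ⟨R, -, hR, -⟩ := h.exists_orthogonal_component hr (satisfiesRecurrence_recPoly r α) hj
  exact stepLineExistsUnique_of_typeIForm hr (isEnumeration_shiftedSystem hr v j)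
    (h.nondegenerate hr hj) (h.isTypeIForm_folded hr hj) hR

theorem decomposition (h : IsSeriesSolution v g α) (hr : 1 ≤ r) {P : ℕ → ℂ[X]}
    (hP : SatisfiesRecurrence r α P) (j : Fin (r + 1)) :
    (∃! Q : ℕ → ℂ[X], IsROrthogonal (shiftedSystem v j) Q) ∧
      ∀ Q : ℕ → ℂ[X], IsROrthogonal (shiftedSystem v j) Q →
        ∀ n : ℕ, P ((r + 1) * n + j) = X ^ (j : ℕ) * (Q n).comp (X ^ (r + 1)) := by
  have hj : (j : ℕ) ≤ r := Nat.lt_succ_iff.1 j.2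
  have he := isEnumeration_shiftedSystem hr v j
  obtain ⟨R, hRP, hR, hR'⟩ := h.exists_orthogonal_component hr hP hj
  have huniq : ∀ Q : ℕ → ℂ[X], IsROrthogonal (shiftedSystem v j) Q → Q = R := fun Q hQ =>
    funext fun n => eq_of_orthogonal (h.isTypeIForm_folded hr hj)
      (((isROrthogonal_iff hr he Q).1 hQ).1 n) (hR n)
  exact ⟨⟨R, (isROrthogonal_iff hr he R).2 ⟨hR, hR'⟩, huniq⟩, fun Q hQ n => by
    rw [huniq Q hQ, hRP]⟩

theorem generating_function (h : IsSeriesSolution v g α) (hr : 1 ≤ r) (j : Fin (r + 1))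
    (m : ℕ) :
    (∃! A : Fin r → ℂ[X], IsTypeI (shiftedSystem v j) (stepLine r (m + 1)) A) ∧
      ∀ A : Fin r → ℂ[X], IsTypeI (shiftedSystem v j) (stepLine r (m + 1)) A →
        g ((r + 1) * m + j + 1) =
          PowerSeries.mk fun n => linearForm (shiftedSystem v j) A (X ^ (n + m)) := by
  have hj : (j : ℕ) ≤ r := Nat.lt_succ_iff.1 j.2
  obtain ⟨h1, h2⟩ := (h.isTypeIForm_folded hr hj m).existsUnique_isTypeI hr
    (isEnumeration_shiftedSystem hr v j) (h.nondegenerate hr hj)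
  refine ⟨h1, fun A hA => PowerSeries.ext fun n => ?_⟩
  rw [PowerSeries.coeff_mk, h2 A hA, folded_X_pow_add]

end IsSeriesSolution

/-! ### Construction of the series from the type I linear forms -/

/-- Relations between the type I forms of consecutive shifted systems. -/
theorem exists_alpha {r : ℕ} (hr : 1 ≤ r) {v : Fin r → Functional} {w : ℕ → ℕ → Functional}
    (hn : ∀ j ≤ r, Nondegenerate fun a => enum hr v (a + j))
    (hw : ∀ j ≤ r, ∀ m, IsTypeIForm (fun a => enum hr v (a + j)) m (w j m)) :
    (∀ j < r, ∀ m, ∃ α : ℂ, α ≠ 0 ∧ w (j + 1) m - w j m = α • w j (m + 1)) ∧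
      (∀ m, ∃ α : ℂ, α ≠ 0 ∧ polyMul X (w 0 (m + 1)) - w r m = α • w r (m + 1)) ∧
      ∃ α : ℂ, α ≠ 0 ∧ polyMul X (w 0 0) = α • w r 0 := by
  have hX : ∀ a, polyMul X (enum hr v (a + 0)) = enum hr v (a + r) := polyMul_X_enum hr v
  refine ⟨fun j hj m => ?_, fun m => ?_, ?_⟩
  · refine (hw j hj.le (m + 1)).exists_eq_smul (hn j hj.le)
      (HasLead.sub (HasLead.of_shift ?_) (hw j hj.le m).lead) fun b hb => ?_
    · simpa only [add_assoc, add_comm 1 j] using (hw (j + 1) hj m).lead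
    · rw [LinearMap.sub_apply]
      rcases Nat.lt_succ_iff_lt_or_eq.1 hb with hb | rfl
      · rw [(hw _ hj m).orthogonal b hb, (hw _ hj.le m).orthogonal b hb, sub_zero]
      -- The normalizations cancel at `x^m`, so the difference vanishes one power further than
      -- either form.
      · rw [(hw _ hj b).normalized, (hw _ hj.le b).normalized, sub_self]
  · refine (hw r le_rfl (m + 1)).exists_eq_smul (hn r le_rfl)
      (((hw 0 (Nat.zero_le r) (m + 1)).lead.polyMul X hX).sub (hw r le_rfl m).lead) fun b hb => ?_
    rw [LinearMap.sub_apply, polyMul_apply, ← pow_succ']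
    rcases Nat.lt_succ_iff_lt_or_eq.1 hb with hb | rfl
    · rw [(hw 0 (Nat.zero_le r) (m + 1)).orthogonal (b + 1) (by omega),
        (hw r le_rfl m).orthogonal b hb, sub_zero]
    · rw [(hw 0 (Nat.zero_le r) (b + 1)).normalized, (hw r le_rfl b).normalized, sub_self]
  · exact (hw r le_rfl 0).exists_eq_smul (hn r le_rfl)
      ((hw 0 (Nat.zero_le r) 0).lead.polyMul X hX) fun b hb => absurd hb (Nat.not_lt_zero b)

/-- The shifted moment generating functions of the type I forms, preceded by `1`. -/
noncomputable def formSeries (r : ℕ) (w : ℕ → ℕ → Functional) : ℕ → PowerSeries ℂ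
  | 0 => 1
  | k + 1 => PowerSeries.mk fun n => w (k % (r + 1)) (k / (r + 1)) (X ^ (n + k / (r + 1)))

theorem formSeries_eq {r : ℕ} (w : ℕ → ℕ → Functional) {j : ℕ} (hj : j ≤ r) (m : ℕ) :
    formSeries r w ((r + 1) * m + j + 1) = PowerSeries.mk fun n => w j m (X ^ (n + m)) := by
  have h1 : ((r + 1) * m + j) % (r + 1) = j := by
    rw [Nat.mul_add_mod, Nat.mod_eq_of_lt (by omega)]
  have h2 : ((r + 1) * m + j) / (r + 1) = m := by
    rw [Nat.mul_add_div (by omega), Nat.div_eq_of_lt (by omega), add_zero]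
  rw [formSeries, h1, h2]

theorem exists_isSeriesSolution {r : ℕ} (hr : 1 ≤ r) {v : Fin r → Functional}
    (hv : ∀ i, v i 1 = 1)
    (h : ∀ j : Fin (r + 1), StepLineExistsUnique (shiftedSystem v j)) :
    ∃ g α, IsSeriesSolution v g α := by
  have hn : ∀ j ≤ r, Nondegenerate fun a => enum hr v (a + j) := fun j hj =>
    (h ⟨j, Nat.lt_succ_of_le hj⟩).nondegenerate hr (isEnumeration_shiftedSystem hr v _)
  -- The choice is made for all `j`, with the dummy value `0` when `j > r`.
  have hex : ∀ j m, ∃ w, j ≤ r → IsTypeIForm (fun a => enum hr v (a + j)) m w := by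
    intro j m
    by_cases hj : j ≤ r
    · obtain ⟨w, hw⟩ := (h ⟨j, Nat.lt_succ_of_le hj⟩).exists_typeIForm hr
        (isEnumeration_shiftedSystem hr v _) m
      exact ⟨w, fun _ => hw⟩
    · exact ⟨0, fun hj' => absurd hj' hj⟩
  choose w hw' using hex
  have hw : ∀ j ≤ r, ∀ m, IsTypeIForm (fun a => enum hr v (a + j)) m (w j m) :=
    fun j hj m => hw' j m hj
  obtain ⟨h1, h2, h3⟩ := exists_alpha hr hn hw
  have hg : ∀ k, PowerSeries.constantCoeff (formSeries r w k) = 1 := by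
    intro k
    cases k with
    | zero => simp [formSeries]
    | succ k =>
      rw [← PowerSeries.coeff_zero_eq_constantCoeff_apply, formSeries, PowerSeries.coeff_mk,
        zero_add]
      exact (hw _ (Nat.lt_succ_iff.1 (Nat.mod_lt _ (Nat.succ_pos r))) _).normalized
  have hrec : ∀ k, ∃ α : ℂ, α ≠ 0 ∧ ∀ n, PowerSeries.coeff (n + 1) (formSeries r w (k + 1)) -
      PowerSeries.coeff (n + 1) (formSeries r w k) =
        α * PowerSeries.coeff n (formSeries r w (k + r + 1)) := by
    intro k
    obtain ⟨m, j, hj, rfl⟩ : ∃ m j, j ≤ r ∧ k = (r + 1) * m + j :=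
      ⟨k / (r + 1), k % (r + 1), Nat.lt_succ_iff.1 (Nat.mod_lt _ (Nat.succ_pos r)),
        (Nat.div_add_mod _ _).symm⟩
    rw [formSeries_eq w hj]
    -- The series `g_k` and `g_{k+1}` belong to neighbouring systems with the same `m` unless `r +
    -- 1` divides `k`; then `g_k` comes from `V^[r]` one level lower, or is `g_0 = 1`.
    cases j with
    | succ j =>
      obtain ⟨α, hα, he⟩ := h1 j hj m
      refine ⟨α, hα, fun n => ?_⟩
      rw [show (r + 1) * m + (j + 1) + r + 1 = (r + 1) * (m + 1) + j + 1 by ring,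
        formSeries_eq w (by omega), ← add_assoc, formSeries_eq w (by omega)]
      simp only [PowerSeries.coeff_mk]
      rw [← LinearMap.sub_apply, he, LinearMap.smul_apply, smul_eq_mul, add_right_comm n 1 m,
        add_assoc n m 1]
    | zero =>
      cases m with
      | succ m =>
        obtain ⟨α, hα, he⟩ := h2 m
        refine ⟨α, hα, fun n => ?_⟩
        rw [add_right_comm _ 0 r, add_zero, formSeries_eq w le_rfl,
          show (r + 1) * (m + 1) = (r + 1) * m + r + 1 by ring, formSeries_eq w le_rfl]
        simp only [PowerSeries.coeff_mk]
        rw [← smul_eq_mul, ← LinearMap.smul_apply, ← he, LinearMap.sub_apply, polyMul_apply,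
          ← pow_succ', show n + 1 + (m + 1) = n + (m + 1) + 1 by ring,
          show n + 1 + m = n + (m + 1) by ring]
      | zero =>
        obtain ⟨α, hα, he⟩ := h3
        refine ⟨α, hα, fun n => ?_⟩
        rw [add_right_comm _ 0 r, add_zero, formSeries_eq w le_rfl, mul_zero]
        simp only [PowerSeries.coeff_mk, formSeries, PowerSeries.coeff_one, Nat.succ_ne_zero,
          if_false, sub_zero, add_zero]
        rw [← smul_eq_mul, ← LinearMap.smul_apply, ← he, polyMul_apply, ← pow_succ']
  choose α hα hrec using hrec
  refine ⟨formSeries r w, α, hg, rfl, fun i => ?_, fun k => ?_, hα⟩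
  -- The form of index `0` is a multiple of `v i`, and `⟨v_i, 1⟩ = 1` makes the factor `1`.
  · have hwi : w i 0 = v i := by
      have := hw i i.2.le 0
      obtain ⟨c, -, hc⟩ := this.lead
      have hc1 : w i 0 = c 0 • v i := by
        rw [hc]
        simp [enum_of_lt hr v i.2]
      have hnorm := this.normalized
      rw [hc1, LinearMap.smul_apply, pow_zero, hv, smul_eq_mul, mul_one] at hnorm
      rw [hc1, hnorm, one_smul]
    have := formSeries_eq w i.2.le 0
    rw [mul_zero, zero_add, hwi] at this
    exact this
  · ext n
    rw [map_sub, mul_assoc, PowerSeries.coeff_C_mul]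
    cases n with
    | zero =>
      rw [PowerSeries.coeff_zero_X_mul, mul_zero]
      simp only [PowerSeries.coeff_zero_eq_constantCoeff_apply, hg, sub_self]
    | succ n => rw [PowerSeries.coeff_succ_X_mul, hrec]

end MOP

theorem mainTheorem3 (r : ℕ) (hr : 1 ≤ r) (v : Fin r → MOP.Functional)
    (hv : ∀ i, v i 1 = 1) :
    ((∃ (g : ℕ → PowerSeries ℂ) (α : ℕ → ℂ), MOP.IsSeriesSolution v g α) ↔
      ∀ j : Fin (r + 1), MOP.StepLineExistsUnique (MOP.shiftedSystem v j)) ∧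
    ∀ (g : ℕ → PowerSeries ℂ) (α : ℕ → ℂ), MOP.IsSeriesSolution v g α →
      -- the symmetric sequence and its decomposition
      ((∃! P : ℕ → ℂ[X], MOP.SatisfiesRecurrence r α P) ∧
        ∀ P : ℕ → ℂ[X], MOP.SatisfiesRecurrence r α P →
          MOP.IsFoldSymmetric r P ∧
          (∃ u : Fin r → MOP.Functional, MOP.IsROrthogonal u P) ∧
          ∀ j : Fin (r + 1),
            (∃! Q : ℕ → ℂ[X], MOP.IsROrthogonal (MOP.shiftedSystem v j) Q) ∧
            ∀ Q : ℕ → ℂ[X], MOP.IsROrthogonal (MOP.shiftedSystem v j) Q →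
              ∀ n : ℕ, P ((r + 1) * n + j) =
                Polynomial.X ^ (j : ℕ) * (Q n).comp (Polynomial.X ^ (r + 1))) ∧
      -- the series as generating functions of moments of the type I linear forms
      (g 0 = 1 ∧
        ∀ (j : Fin (r + 1)) (m : ℕ),
          (∃! A : Fin r → ℂ[X],
            MOP.IsTypeI (MOP.shiftedSystem v j) (MOP.stepLine r (m + 1)) A) ∧
          ∀ A : Fin r → ℂ[X],
            MOP.IsTypeI (MOP.shiftedSystem v j) (MOP.stepLine r (m + 1)) A →
              g ((r + 1) * m + j + 1) =
                PowerSeries.mk fun n =>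
                  MOP.linearForm (MOP.shiftedSystem v j) A (Polynomial.X ^ (n + m))) := by
  refine ⟨⟨?_, MOP.exists_isSeriesSolution hr hv⟩, fun g α h => ⟨⟨?_, fun P hP => ?_⟩, ?_⟩⟩
  · rintro ⟨g, α, h⟩
    exact h.stepLineExistsUnique hr
  · exact ⟨_, MOP.satisfiesRecurrence_recPoly r α, fun P hP =>
      hP.eq (MOP.satisfiesRecurrence_recPoly r α)⟩
  · exact ⟨hP.isFoldSymmetric, ⟨_, h.isROrthogonal_unfolded hP⟩, h.decomposition hr hP⟩
  · exact ⟨h.zero_eq, h.generating_function hr⟩
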